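/- Let $n\ge 2$, let $\Delta=\{p\in\mathbb R^n: p_i>0,\ \sum_i p_i=1\}$ be the open unit simplex with closure $\overline\Delta$, and let $m$ be the surface measure ($(n-1)$-dimensional Lebesgue measure) on $\Delta$. A portfolio is a Borel map $\pi:\Delta\to\overline\Delta$; write $\pi(p)/p=(\pi_1(p)/p_1,\dots,\pi_n(p)/p_n)$. Let $\mathcal{FG}$ be the set of pairs $(\pi,\Phi)$ where $\pi$ is a portfolio and $\Phi:\Delta\to(0,\infty)$ is a concave function generating it, i.e. $$1+\Big\langle \frac{\pi(p)}{p},\,q-p\Big\rangle\ \ge\ \frac{\Phi(q)}{\Phi(p)}\qquad\text{for all }p,q\in\Delta,$$ and for $(\pi,\Phi)\in\mathcal{FG}$ let $$T_{\pi,\Phi}(q\mid p)=\log\Big(1+\Big\langle \frac{\pi(p)}{p},\,q-p\Big\rangle\Big)-\log\frac{\Phi(q)}{\Phi(p)},\qquad p,q\in\Delta.$$ Let $\mathbb P$ be a Borel probability measure on $\Delta\times\Delta$ that is either discrete (carried by a countable set) or absolutely continuous with respect to $m\otimes m$, and suppose that $\mathbb P$ is supported on $K\times K$, i.e. $\mathbb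 P(K\times K)=1$, for some compact $K\subset\Delta$. Then $\int T_{\pi,\Phi}(q\mid p)\,d\mathbb P(p,q)$ is a finite integral for every $(\pi,\Phi)\in\mathcal{FG}$, and: (i) The optimization problem $$\max_{(\pi,\Phi)\in\mathcal{FG}}\ \int T_{\pi,\Phi}(q\mid p)\,d\mathbb P(p,q)$$ has an optimal solution (the maximum is attained). (ii) If $(\pi^{(1)},\Phi^{(1)})$ and $(\pi^{(2)},\Phi^{(2)})$ are optimal solutions, then $$\Big\langle \frac{\pi^{(1)}(p)}{p},\,q-p\Big\rangle=\Big\langle \frac{\pi^{(2)}(p)}{p},\,q-p\Big\rangle\qquad\text{for }\mathbb P\text{-almost all }(p,q).$$ In particular, suppose that $\mathbb P$ is absolutely continuous, $\mathbb P(dp\,dq)=\mathbb P_1(dp)\,\mathbb P_2(dq\mid p)$ with $\mathbb P_1(dp)=f(p)\,m(dp)$, and that $\mathbb P$ satisfies the support condition: for $m$-almost all $p$ with $f(p)>0$ and for all $v\in\mathbb R^n$ with $\sum_i v_i=0$ there exists $\lambda>0$ such that $p+\lambda v$ belongs to the support of $\mathbb P_2(\cdot\mid p)$. Then $\pi^{(1)}=\pi^{(2)}$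 $m$-almost everywhere on $\{p: f(p)>0\}$. -/

import Mathlib

open MeasureTheory ProbabilityTheory
open scoped ENNReal

/-- The open unit simplex `Δ⁽ⁿ⁾` in `ℝⁿ` (with the Euclidean metric). -/
def openSimplex (n : ℕ) : Set (EuclideanSpace ℝ (Fin n)) :=
  {p | (∀ i, 0 < p i) ∧ ∑ i, p i = 1}

/-- The closed unit simplex; it is the closure of the open one, see
`closedSimplex_eq_closure`. -/
def closedSimplex (n : ℕ) : Set (EuclideanSpace ℝ (Fin n)) :=
  {p | (∀ i, 0 ≤ p i) ∧ ∑ i, p i = 1}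

theorem closedSimplex_eq_closure (n : ℕ) : closedSimplex n = closure (openSimplex n) := by
  apply Set.Subset.antisymm
  · intro x hx
    have hn : (0 : ℝ) < n := by
      rcases Nat.eq_zero_or_pos n with h | h
      · subst h
        have h2 := hx.2
        simp at h2
      · exact_mod_cast h
    let c : EuclideanSpace ℝ (Fin n) := WithLp.toLp 2 (fun _ => (1 / (n : ℝ)))
    have hcont : Continuous (fun t : ℝ => (1 - t) • x + t • c) := by fun_prop
    have hlim : Filter.Tendsto (fun t : ℝ => (1 - t) • x + t • c)
        (nhdsWithin 0 (Set.Ioi 0)) (nhds x) := by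
      have := hcont.tendsto 0
      simp only [sub_zero, one_smul, zero_smul, add_zero] at this
      exact this.mono_left nhdsWithin_le_nhds
    refine mem_closure_of_tendsto hlim ?_
    have hmem : Set.Ioo (0 : ℝ) 1 ∈ nhdsWithin (0 : ℝ) (Set.Ioi 0) :=
      Ioo_mem_nhdsGT one_pos
    filter_upwards [hmem] with t ht
    refine ⟨fun i => ?_, ?_⟩
    · have h1 := mul_nonneg (sub_nonneg.2 ht.2.le) (hx.1 i)
      have h2 : 0 < t * (1 / (n : ℝ)) := by have := ht.1; positivity
      simp only [PiLp.add_apply, PiLp.smul_apply, smul_eq_mul, c]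
      linarith
    · simp only [PiLp.add_apply, PiLp.smul_apply, smul_eq_mul, c, Finset.sum_add_distrib,
        ← Finset.mul_sum, hx.2]
      simp
      field_simp
      ring
  · refine closure_minimal (fun p hp => ⟨fun i => (hp.1 i).le, hp.2⟩) ?_
    have : closedSimplex n = (⋂ i, {p | 0 ≤ p i}) ∩ {p | ∑ i, p i = 1} := by
      ext p
      simp [closedSimplex]
    rw [this]
    refine (isClosed_iInter fun i => ?_).inter ?_
    · exact isClosed_le continuous_const (by fun_prop)
    · exact isClosed_eq (by fun_prop) continuous_const

/-- The pairing `⟨π(p)/p, q - p⟩ = ∑ᵢ (πᵢ(p) / pᵢ) (qᵢ - pᵢ)` of the weight ratio of the portfolio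
`π` at `p` with the displacement `q - p`. -/
noncomputable def weightRatioPairing {n : ℕ} (π : openSimplex n → closedSimplex n)
    (p q : openSimplex n) : ℝ :=
  ∑ i, (π p).1 i / p.1 i * (q.1 i - p.1 i)

/-- `(π, Φ) ∈ FG`: the portfolio `π`, a Borel map from the open to the closed simplex, is generated
by the positive concave function `Φ` on the open simplex. Only the values of `Φ` on the open simplex
matter. -/
structure IsFunctionallyGenerated {n : ℕ} (π : openSimplex n → closedSimplex n)
    (Φ : EuclideanSpace ℝ (Fin n) → ℝ) : Prop where
  measurable : Measurable π
  concave : ConcaveOn ℝ (openSimplex n) Φ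
  pos : ∀ p ∈ openSimplex n, 0 < Φ p
  superdiff : ∀ p q : openSimplex n, Φ q / Φ p ≤ 1 + weightRatioPairing π p q

/-- The L-divergence `T(q ∣ p)` of the pair `(π, Φ)`. -/
noncomputable def LDivergence {n : ℕ} (π : openSimplex n → closedSimplex n)
    (Φ : EuclideanSpace ℝ (Fin n) → ℝ) (q p : openSimplex n) : ℝ :=
  Real.log (1 + weightRatioPairing π p q) - Real.log (Φ q / Φ p)

/-- The surface measure `m` of the open simplex: `(n - 1)`-dimensional Hausdorff measure for the
Euclidean metric, normalized to agree with Lebesgue measure in dimension `n - 1`. -/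
noncomputable def simplexMeasure (n : ℕ) : Measure (openSimplex n) :=
  Measure.euclideanHausdorffMeasure (n - 1)

/-- `P` is a discrete measure: it is carried by a countable set. -/
def IsDiscreteMeasure {α : Type*} [MeasurableSpace α] (P : Measure α) : Prop :=
  ∃ S : Set α, S.Countable ∧ P Sᶜ = 0

/-- `(π, Φ)` is an optimal solution: it maximizes `∫ T(q ∣ p) dP(p, q)` over all functionally
generated portfolios. -/
def IsOptimalPortfolio {n : ℕ} (P : Measure (openSimplex n × openSimplex n))
    (π : openSimplex n → closedSimplex n) (Φ : EuclideanSpace ℝ (Fin n) → ℝ) : Prop :=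
  IsFunctionallyGenerated π Φ ∧
    ∀ (π' : openSimplex n → closedSimplex n) (Φ' : EuclideanSpace ℝ (Fin n) → ℝ),
      IsFunctionallyGenerated π' Φ' →
        ∫ x, LDivergence π' Φ' x.2 x.1 ∂P ≤ ∫ x, LDivergence π Φ x.2 x.1 ∂P

/-- The support condition, for the first marginal `f(p) m(dp)` and the conditional distribution
`P₂(dq ∣ p) = κ p`: for `m`-almost all `p` with `f p > 0`, every tangent vector `v` (`∑ᵢ vᵢ = 0`)
has a multiple `λ v`, `λ > 0`, with `p + λ v` in the support of `κ p`. -/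
def SupportCondition {n : ℕ} (f : openSimplex n → ℝ≥0∞)
    (κ : Kernel (openSimplex n) (openSimplex n)) : Prop :=
  ∀ᵐ p ∂(simplexMeasure n), 0 < f p →
    ∀ v : EuclideanSpace ℝ (Fin n), ∑ i, v i = 0 →
      ∃ c : ℝ, 0 < c ∧ ∃ q ∈ (κ p).support,
        (q : EuclideanSpace ℝ (Fin n)) = (p : EuclideanSpace ℝ (Fin n)) + c • v

/-! The objective is strongly concave. If `Φ₁`, `Φ₂` generate `π₁`, `π₂`, then by AM-GM the
geometric mean of `Φ₁`, `Φ₂` generates the midpoint portfolio. The terms `log Φ` average exactly. On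
coordinates bounded below by `δ`, the quantity `1 + weightRatioPairing` lies in `[δ, δ⁻¹]`, where
`log` is strongly concave. Hence the midpoint beats the average by at least `δ ^ 2 / 8` times the
squared `L²` distance of the pairings (`integral_sq_sub_le`). Two maximizers therefore have the same
pairings almost everywhere.

For existence, take a maximizing sequence with gaps `4⁻ᵏ`. The same inequality makes the pairings
Cauchy in `L¹` at a geometric rate, so they converge almost everywhere without passing to a
subsequence. The functions `log Φ`, normalized at a point, are equicontinuous and converge along a
subsequence. The portfolios themselves need not converge where `P` gives no control, so a limit
point `ρ p` is selected measurably, along indices depending on `p`. The generating inequality at `p`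
survives this limit, and the almost everywhere limit of the pairings must be the pairing of `ρ`.
Dominated convergence then shows that the supremum is attained. -/

open Filter Topology

/-! ### Geometry of the simplex: logarithmic distance and compact subsets. -/

namespace openSimplex

variable {n : ℕ}

theorem le_one (p : openSimplex n) (i : Fin n) : p.1 i ≤ 1 := by
  rw [← p.2.2]
  exact Finset.single_le_sum (f := fun i => p.1 i) (fun j _ => (p.2.1 j).le) (Finset.mem_univ i)

theorem convex : Convex ℝ (openSimplex n) := by
  intro x hx y hy a b ha hb hab
  refine ⟨fun i => ?_, ?_⟩
  · simp only [PiLp.add_apply, PiLp.smul_apply, smul_eq_mul]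
    rcases ha.eq_or_lt with rfl | ha'
    · have : b = 1 := by linarith
      simpa [this] using hy.1 i
    · have h1 := mul_pos ha' (hx.1 i)
      have h2 := mul_nonneg hb (hy.1 i).le
      linarith
  · simp only [PiLp.add_apply, PiLp.smul_apply, smul_eq_mul, Finset.sum_add_distrib,
      ← Finset.mul_sum, hx.2, hy.2]
    linarith

/-- The `ℓ¹` distance of the logarithms of the coordinates. -/
noncomputable def logDist (p q : openSimplex n) : ℝ :=
  ∑ i, |Real.log (q.1 i) - Real.log (p.1 i)|

theorem logDist_comm (p q : openSimplex n) : logDist p q = logDist q p := by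
  simp only [logDist, abs_sub_comm]

theorem logDist_self (p : openSimplex n) : logDist p p = 0 := by simp [logDist]

theorem continuous_logDist (p : openSimplex n) : Continuous (logDist p) := by
  unfold logDist
  refine continuous_finsetSum _ fun i _ => Continuous.abs (Continuous.sub ?_ continuous_const)
  exact Continuous.log (by fun_prop) fun q => (q.2.1 i).ne'

theorem div_le_exp_logDist (p q : openSimplex n) (i : Fin n) :
    q.1 i / p.1 i ≤ Real.exp (logDist p q) := by
  have hp := p.2.1 i
  have hq := q.2.1 i
  rw [← Real.log_le_iff_le_exp (by positivity), Real.log_div hq.ne' hp.ne']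
  refine (le_abs_self _).trans ?_
  exact Finset.single_le_sum (f := fun i => |Real.log (q.1 i) - Real.log (p.1 i)|)
    (fun j _ => abs_nonneg _) (Finset.mem_univ i)

theorem exists_forall_le_of_isCompact {K : Set (openSimplex n)} (hK : IsCompact K) :
    ∃ δ : ℝ, 0 < δ ∧ ∀ p ∈ K, ∀ i, δ ≤ p.1 i := by
  have key : ∀ i : Fin n, ∃ δ : ℝ, 0 < δ ∧ ∀ p ∈ K, δ ≤ p.1 i := by
    intro i
    rcases K.eq_empty_or_nonempty with rfl | hne
    · exact ⟨1, one_pos, by simp⟩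
    · obtain ⟨x, hx, hmin⟩ := hK.exists_isMinOn hne
        (f := fun p : openSimplex n => p.1 i) (by fun_prop)
      exact ⟨x.1 i, x.2.1 i, fun p hp => hmin hp⟩
  choose d hd hdK using key
  rcases isEmpty_or_nonempty (Fin n) with h | h
  · exact ⟨1, one_pos, fun p _ i => h.elim i⟩
  · refine ⟨Finset.univ.inf' Finset.univ_nonempty d, ?_, fun p hp i => ?_⟩
    · rw [Finset.lt_inf'_iff]
      exact fun i _ => hd i
    · exact (Finset.inf'_le d (Finset.mem_univ i)).trans (hdK i p hp)

end openSimplex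

open openSimplex

/-! ### The pairing as a weighted mean of coordinate ratios. -/

section Pairing

variable {n : ℕ} (π : openSimplex n → closedSimplex n)

/-- As a convex combination of the ratios `q i / p i`, this quantity inherits any bound common to
all the ratios, whatever the portfolio. -/
theorem one_add_weightRatioPairing (p q : openSimplex n) :
    1 + weightRatioPairing π p q = ∑ i, (π p).1 i * (q.1 i / p.1 i) := by
  rw [weightRatioPairing, ← (π p).2.2, ← Finset.sum_add_distrib]
  refine Finset.sum_congr rfl fun i _ => ?_
  have := (p.2.1 i).ne'
  field_simp
  ring

theorem one_add_weightRatioPairing_le {p q : openSimplex n} {b : ℝ}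
    (h : ∀ i, q.1 i / p.1 i ≤ b) : 1 + weightRatioPairing π p q ≤ b := by
  rw [one_add_weightRatioPairing]
  calc _ ≤ ∑ i, (π p).1 i * b :=
        Finset.sum_le_sum fun i _ => mul_le_mul_of_nonneg_left (h i) ((π p).2.1 i)
    _ = b := by rw [← Finset.sum_mul, (π p).2.2, one_mul]

theorem le_one_add_weightRatioPairing {p q : openSimplex n} {a : ℝ}
    (h : ∀ i, a ≤ q.1 i / p.1 i) : a ≤ 1 + weightRatioPairing π p q := by
  rw [one_add_weightRatioPairing]
  calc a = ∑ i, (π p).1 i * a := by rw [← Finset.sum_mul, (π p).2.2, one_mul]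
    _ ≤ _ := Finset.sum_le_sum fun i _ => mul_le_mul_of_nonneg_left (h i) ((π p).2.1 i)

theorem one_add_weightRatioPairing_mem_Icc {δ : ℝ} (hδ : 0 < δ) {p q : openSimplex n}
    (hp : ∀ i, δ ≤ p.1 i) (hq : ∀ i, δ ≤ q.1 i) :
    1 + weightRatioPairing π p q ∈ Set.Icc δ δ⁻¹ := by
  constructor
  · refine le_one_add_weightRatioPairing π fun i => ?_
    rw [le_div_iff₀ (p.2.1 i)]
    nlinarith [hq i, le_one p i]
  · refine one_add_weightRatioPairing_le π fun i => ?_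
    rw [← one_div]
    exact div_le_div₀ zero_le_one (le_one q i) hδ (hp i)

variable {π}

theorem measurable_weightRatioPairing (hπ : Measurable π) :
    Measurable fun x : openSimplex n × openSimplex n => weightRatioPairing π x.1 x.2 := by
  unfold weightRatioPairing
  have h0 (i : Fin n) : Measurable fun p : EuclideanSpace ℝ (Fin n) => p i := by fun_prop
  refine Finset.measurable_sum _ fun i _ => ?_
  have h1 : Measurable fun x : openSimplex n × openSimplex n => (π x.1).1 i :=
    (h0 i).comp (measurable_subtype_coe.comp (hπ.comp measurable_fst))
  have h2 : Measurable fun x : openSimplex n × openSimplex n => x.1.1 i :=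
    (h0 i).comp (measurable_subtype_coe.comp measurable_fst)
  have h3 : Measurable fun x : openSimplex n × openSimplex n => x.2.1 i :=
    (h0 i).comp (measurable_subtype_coe.comp measurable_snd)
  exact (h1.div h2).mul (h3.sub h2)

end Pairing

/-! ### Uniform estimates for functionally generated pairs. -/

namespace IsFunctionallyGenerated

variable {n : ℕ} {π π₁ π₂ : openSimplex n → closedSimplex n}
  {Φ Φ₁ Φ₂ : EuclideanSpace ℝ (Fin n) → ℝ}

/-- The superdifferential inequality implies concavity. -/
theorem of_superdiff (hπ : Measurable π) (hpos : ∀ p ∈ openSimplex n, 0 < Φ p)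
    (hsup : ∀ p q : openSimplex n, Φ q / Φ p ≤ 1 + weightRatioPairing π p q) :
    IsFunctionallyGenerated π Φ := by
  refine ⟨hπ, ⟨convex, fun x hx y hy a b ha hb hab => ?_⟩, hpos, hsup⟩
  set m : openSimplex n := ⟨a • x + b • y, convex hx hy ha hb hab⟩ with hm
  have hmpos : 0 < Φ m := hpos _ m.2
  have h1 := (div_le_iff₀ hmpos).1 (hsup m ⟨x, hx⟩)
  have h2 := (div_le_iff₀ hmpos).1 (hsup m ⟨y, hy⟩)
  -- The pairing based at `m` is affine in its second argument and vanishes at `m` itself.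
  have h3 : a * weightRatioPairing π m ⟨x, hx⟩ + b * weightRatioPairing π m ⟨y, hy⟩ = 0 := by
    simp only [weightRatioPairing, Finset.mul_sum, ← Finset.sum_add_distrib]
    refine Finset.sum_eq_zero fun i _ => ?_
    have : m.1 i = a * x i + b * y i := by simp [hm]
    have hb' : b = 1 - a := by linarith
    rw [this, hb']
    ring
  have h4 := mul_le_mul_of_nonneg_left h1 ha
  have h5 := mul_le_mul_of_nonneg_left h2 hb
  simp only [smul_eq_mul]
  change a * Φ x + b * Φ y ≤ Φ m
  calc a * Φ x + b * Φ y
      ≤ a * ((1 + weightRatioPairing π m ⟨x, hx⟩) * Φ m)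
        + b * ((1 + weightRatioPairing π m ⟨y, hy⟩) * Φ m) := add_le_add h4 h5
    _ = (a + b + (a * weightRatioPairing π m ⟨x, hx⟩
        + b * weightRatioPairing π m ⟨y, hy⟩)) * Φ m := by ring
    _ = Φ m := by rw [h3, hab]; ring

theorem one_add_weightRatioPairing_pos (h : IsFunctionallyGenerated π Φ) (p q : openSimplex n) :
    0 < 1 + weightRatioPairing π p q :=
  (div_pos (h.pos _ q.2) (h.pos _ p.2)).trans_le (h.superdiff p q)

theorem log_sub_log_le (h : IsFunctionallyGenerated π Φ) (p q : openSimplex n) :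
    Real.log (Φ q) - Real.log (Φ p) ≤ Real.log (1 + weightRatioPairing π p q) := by
  have hp := h.pos _ p.2
  have hq := h.pos _ q.2
  rw [← Real.log_div hq.ne' hp.ne']
  exact Real.log_le_log (div_pos hq hp) (h.superdiff p q)

/-- The modulus of continuity does not depend on `(π, Φ)`; this gives the equicontinuity behind the
compactness argument. -/
theorem abs_log_sub_log_le (h : IsFunctionallyGenerated π Φ) (p q : openSimplex n) :
    |Real.log (Φ q) - Real.log (Φ p)| ≤ logDist p q := by
  have key : ∀ p q : openSimplex n, Real.log (Φ q) - Real.log (Φ p) ≤ logDist p q :=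
    fun p q => (h.log_sub_log_le p q).trans <| by
      rw [Real.log_le_iff_le_exp (h.one_add_weightRatioPairing_pos p q)]
      exact one_add_weightRatioPairing_le π (div_le_exp_logDist p q)
  refine abs_le.2 ⟨?_, key p q⟩
  have := key q p
  rw [logDist_comm] at this
  linarith

theorem continuous_log (h : IsFunctionallyGenerated π Φ) :
    Continuous fun p : openSimplex n => Real.log (Φ p) := by
  rw [continuous_iff_continuousAt]
  intro p
  rw [ContinuousAt, tendsto_iff_dist_tendsto_zero]
  have h0 := (continuous_logDist p).tendsto p
  rw [logDist_self] at h0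
  exact squeeze_zero (fun _ => dist_nonneg) (fun q => h.abs_log_sub_log_le p q) h0

theorem lDivergence_eq (h : IsFunctionallyGenerated π Φ) (p q : openSimplex n) :
    LDivergence π Φ q p =
      Real.log (1 + weightRatioPairing π p q) - (Real.log (Φ q) - Real.log (Φ p)) := by
  rw [LDivergence, Real.log_div (h.pos _ q.2).ne' (h.pos _ p.2).ne']

theorem lDivergence_nonneg (h : IsFunctionallyGenerated π Φ) (p q : openSimplex n) :
    0 ≤ LDivergence π Φ q p := by
  rw [h.lDivergence_eq]
  linarith [h.log_sub_log_le p q]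

theorem measurable_lDivergence (h : IsFunctionallyGenerated π Φ) :
    Measurable fun x : openSimplex n × openSimplex n => LDivergence π Φ x.2 x.1 := by
  simp only [h.lDivergence_eq]
  have h1 := measurable_weightRatioPairing h.measurable
  have h2 := h.continuous_log.measurable
  exact (Real.measurable_log.comp (measurable_const.add h1)).sub
    ((h2.comp measurable_snd).sub (h2.comp measurable_fst))

/-- Each of the two terms contributes `log δ⁻¹`; the one in `Φ` is bounded by the generating
inequality with `p` and `q` exchanged. -/
theorem lDivergence_le (h : IsFunctionallyGenerated π Φ) {δ : ℝ} (hδ : 0 < δ)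
    {p q : openSimplex n} (hp : ∀ i, δ ≤ p.1 i) (hq : ∀ i, δ ≤ q.1 i) :
    LDivergence π Φ q p ≤ 2 * Real.log δ⁻¹ := by
  have h1 := Real.log_le_log (h.one_add_weightRatioPairing_pos p q)
    (one_add_weightRatioPairing_mem_Icc π hδ hp hq).2
  have h2 := Real.log_le_log (h.one_add_weightRatioPairing_pos q p)
    (one_add_weightRatioPairing_mem_Icc π hδ hq hp).2
  rw [h.lDivergence_eq]
  linarith [h.log_sub_log_le q p]

end IsFunctionallyGenerated

/-- The market portfolio `π(p) = p` is generated by the constant function. -/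
theorem isFunctionallyGenerated_market (n : ℕ) :
    IsFunctionallyGenerated
      (fun p : openSimplex n => (⟨p.1, fun i => (p.2.1 i).le, p.2.2⟩ : closedSimplex n))
      (fun _ => 1) := by
  refine .of_superdiff (measurable_subtype_coe.subtype_mk) (fun _ _ => one_pos) fun p q => ?_
  rw [one_add_weightRatioPairing, div_one]
  refine (q.2.2.symm.trans (Finset.sum_congr rfl fun i _ => ?_)).le
  have := (p.2.1 i).ne'
  field_simp

/-! ### Strong concavity of the objective. -/

/-- The pointwise midpoint of two portfolios. -/
noncomputable def portfolioMidpoint {n : ℕ} (π₁ π₂ : openSimplex n → closedSimplex n) :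
    openSimplex n → closedSimplex n := fun p =>
  ⟨(2⁻¹ : ℝ) • ((π₁ p).1 + (π₂ p).1),
    fun i => by
      have h1 := (π₁ p).2.1 i
      have h2 := (π₂ p).2.1 i
      simp only [PiLp.add_apply, PiLp.smul_apply, smul_eq_mul]
      linarith,
    by
      simp only [PiLp.add_apply, PiLp.smul_apply, smul_eq_mul, ← Finset.mul_sum,
        Finset.sum_add_distrib, (π₁ p).2.2, (π₂ p).2.2]
      norm_num⟩

theorem weightRatioPairing_portfolioMidpoint {n : ℕ} (π₁ π₂ : openSimplex n → closedSimplex n)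
    (p q : openSimplex n) :
    weightRatioPairing (portfolioMidpoint π₁ π₂) p q =
      (weightRatioPairing π₁ p q + weightRatioPairing π₂ p q) / 2 := by
  simp only [weightRatioPairing, portfolioMidpoint, PiLp.add_apply, PiLp.smul_apply, smul_eq_mul,
    ← Finset.sum_add_distrib, Finset.sum_div]
  exact Finset.sum_congr rfl fun i _ => by ring

/-- Apply `log x ≥ 1 - x⁻¹` to the ratio of the squared arithmetic mean to `a * b`. The right side
becomes `(a - b) ^ 2 / (a + b) ^ 2`, and `a + b ≤ 2 / δ`. -/
theorem log_midpoint_sub_ge {δ a b : ℝ} (hδ : 0 < δ) (ha : a ∈ Set.Icc δ δ⁻¹)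
    (hb : b ∈ Set.Icc δ δ⁻¹) :
    (Real.log a + Real.log b) / 2 + δ ^ 2 / 8 * (a - b) ^ 2 ≤ Real.log ((a + b) / 2) := by
  have ha0 : 0 < a := hδ.trans_le ha.1
  have hb0 : 0 < b := hδ.trans_le hb.1
  have h1 := Real.one_sub_inv_le_log_of_pos (x := ((a + b) / 2) ^ 2 / (a * b)) (by positivity)
  rw [Real.log_div (by positivity) (by positivity), Real.log_pow,
    Real.log_mul ha0.ne' hb0.ne'] at h1
  have h2 : 1 - (((a + b) / 2) ^ 2 / (a * b))⁻¹ = (a - b) ^ 2 / (a + b) ^ 2 := by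
    field_simp
    ring
  have h3 : (a + b) ^ 2 * (δ ^ 2 / 4) ≤ 1 := by
    have h4 : (a + b) * δ ≤ 2 := by
      calc (a + b) * δ ≤ (δ⁻¹ + δ⁻¹) * δ := by
            gcongr
            exacts [ha.2, hb.2]
        _ = 2 := by field_simp; norm_num
    have h5 : 0 ≤ (a + b) * δ := by positivity
    nlinarith
  have h6 : δ ^ 2 / 4 * (a - b) ^ 2 ≤ (a - b) ^ 2 / (a + b) ^ 2 := by
    rw [le_div_iff₀ (by positivity)]
    nlinarith [mul_le_mul_of_nonneg_left h3 (sq_nonneg (a - b))]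
  push_cast at h1
  linarith

namespace IsFunctionallyGenerated

variable {n : ℕ} {π π₁ π₂ : openSimplex n → closedSimplex n}
  {Φ Φ₁ Φ₂ : EuclideanSpace ℝ (Fin n) → ℝ}

/-- The geometric mean of the two generating inequalities, followed by AM-GM on the right-hand
sides. -/
theorem midpoint (h₁ : IsFunctionallyGenerated π₁ Φ₁) (h₂ : IsFunctionallyGenerated π₂ Φ₂) :
    IsFunctionallyGenerated (portfolioMidpoint π₁ π₂)
      (fun p => Real.exp ((Real.log (Φ₁ p) + Real.log (Φ₂ p)) / 2)) := by
  refine .of_superdiff ?_ (fun _ _ => Real.exp_pos _) fun p q => ?_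
  · refine Measurable.subtype_mk ?_
    have m₁ : Measurable fun p => (π₁ p).1 := measurable_subtype_coe.comp h₁.measurable
    have m₂ : Measurable fun p => (π₂ p).1 := measurable_subtype_coe.comp h₂.measurable
    exact (m₁.add m₂).const_smul (2⁻¹ : ℝ)
  · rw [weightRatioPairing_portfolioMidpoint, ← Real.exp_sub]
    have u₁ := h₁.one_add_weightRatioPairing_pos p q
    have u₂ := h₂.one_add_weightRatioPairing_pos p q
    have l₁ := h₁.log_sub_log_le p q
    have l₂ := h₂.log_sub_log_le p q
    have e₁ := Real.exp_log u₁
    have e₂ := Real.exp_log u₂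
    calc _ ≤ Real.exp ((Real.log (1 + weightRatioPairing π₁ p q)
          + Real.log (1 + weightRatioPairing π₂ p q)) / 2) := Real.exp_le_exp.2 (by linarith)
      _ ≤ _ := by
        have e₃ : Real.exp ((Real.log (1 + weightRatioPairing π₁ p q)
            + Real.log (1 + weightRatioPairing π₂ p q)) / 2) =
            Real.exp (Real.log (1 + weightRatioPairing π₁ p q) / 2) *
            Real.exp (Real.log (1 + weightRatioPairing π₂ p q) / 2) := by
          rw [← Real.exp_add]; ring_nf
        have s₁ : Real.exp (Real.log (1 + weightRatioPairing π₁ p q) / 2) ^ 2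
            = 1 + weightRatioPairing π₁ p q := by
          rw [← Real.exp_nat_mul]; push_cast; rw [mul_div_cancel₀ _ two_ne_zero, e₁]
        have s₂ : Real.exp (Real.log (1 + weightRatioPairing π₂ p q) / 2) ^ 2
            = 1 + weightRatioPairing π₂ p q := by
          rw [← Real.exp_nat_mul]; push_cast; rw [mul_div_cancel₀ _ two_ne_zero, e₂]
        rw [e₃]
        nlinarith [sq_nonneg (Real.exp (Real.log (1 + weightRatioPairing π₁ p q) / 2) -
            Real.exp (Real.log (1 + weightRatioPairing π₂ p q) / 2))]

theorem lDivergence_midpoint_ge (h₁ : IsFunctionallyGenerated π₁ Φ₁)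
    (h₂ : IsFunctionallyGenerated π₂ Φ₂) {δ : ℝ} (hδ : 0 < δ)
    {p q : openSimplex n} (hp : ∀ i, δ ≤ p.1 i) (hq : ∀ i, δ ≤ q.1 i) :
    (LDivergence π₁ Φ₁ q p + LDivergence π₂ Φ₂ q p) / 2 +
        δ ^ 2 / 8 * (weightRatioPairing π₁ p q - weightRatioPairing π₂ p q) ^ 2 ≤
      LDivergence (portfolioMidpoint π₁ π₂)
        (fun p => Real.exp ((Real.log (Φ₁ p) + Real.log (Φ₂ p)) / 2)) q p := by
  have := log_midpoint_sub_ge hδ (one_add_weightRatioPairing_mem_Icc π₁ hδ hp hq)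
    (one_add_weightRatioPairing_mem_Icc π₂ hδ hp hq)
  rw [(h₁.midpoint h₂).lDivergence_eq, h₁.lDivergence_eq, h₂.lDivergence_eq, Real.log_exp,
    Real.log_exp, weightRatioPairing_portfolioMidpoint]
  rw [add_sub_add_left_eq_sub] at this
  have e : (1 + weightRatioPairing π₁ p q + (1 + weightRatioPairing π₂ p q)) / 2 =
    1 + (weightRatioPairing π₁ p q + weightRatioPairing π₂ p q) / 2 := by ring
  rw [e] at this
  linarith

end IsFunctionallyGenerated

namespace IsFunctionallyGenerated

variable {n : ℕ} {π π₁ π₂ : openSimplex n → closedSimplex n}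
  {Φ Φ₁ Φ₂ : EuclideanSpace ℝ (Fin n) → ℝ}
  {P : Measure (openSimplex n × openSimplex n)} {δ : ℝ}

theorem norm_lDivergence_le (h : IsFunctionallyGenerated π Φ) (hδ : 0 < δ)
    (hP : ∀ᵐ x ∂P, (∀ i, δ ≤ x.1.1 i) ∧ ∀ i, δ ≤ x.2.1 i) :
    ∀ᵐ x ∂P, ‖LDivergence π Φ x.2 x.1‖ ≤ 2 * Real.log δ⁻¹ := by
  filter_upwards [hP] with x hx
  rw [Real.norm_of_nonneg (h.lDivergence_nonneg _ _)]
  exact h.lDivergence_le hδ hx.1 hx.2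

variable [IsProbabilityMeasure P]

theorem integrable_lDivergence (h : IsFunctionallyGenerated π Φ) (hδ : 0 < δ)
    (hP : ∀ᵐ x ∂P, (∀ i, δ ≤ x.1.1 i) ∧ ∀ i, δ ≤ x.2.1 i) :
    Integrable (fun x => LDivergence π Φ x.2 x.1) P :=
  .of_bound h.measurable_lDivergence.aestronglyMeasurable _ (h.norm_lDivergence_le hδ hP)

theorem integral_lDivergence_le (h : IsFunctionallyGenerated π Φ) (hδ : 0 < δ)
    (hP : ∀ᵐ x ∂P, (∀ i, δ ≤ x.1.1 i) ∧ ∀ i, δ ≤ x.2.1 i) :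
    ∫ x, LDivergence π Φ x.2 x.1 ∂P ≤ 2 * Real.log δ⁻¹ := by
  have := norm_integral_le_of_norm_le_const (h.norm_lDivergence_le hδ hP)
  rw [probReal_univ, mul_one] at this
  exact (le_abs_self _).trans this

theorem integrable_sq_sub (h₁ : IsFunctionallyGenerated π₁ Φ₁)
    (h₂ : IsFunctionallyGenerated π₂ Φ₂) (hδ : 0 < δ)
    (hP : ∀ᵐ x ∂P, (∀ i, δ ≤ x.1.1 i) ∧ ∀ i, δ ≤ x.2.1 i) :
    Integrable (fun x =>
      (weightRatioPairing π₁ x.1 x.2 - weightRatioPairing π₂ x.1 x.2) ^ 2) P := by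
  refine .of_bound (((measurable_weightRatioPairing h₁.measurable).sub
    (measurable_weightRatioPairing h₂.measurable)).pow_const 2).aestronglyMeasurable
    ((δ⁻¹) ^ 2) ?_
  filter_upwards [hP] with x hx
  have a₁ := one_add_weightRatioPairing_mem_Icc π₁ hδ hx.1 hx.2
  have a₂ := one_add_weightRatioPairing_mem_Icc π₂ hδ hx.1 hx.2
  rw [Real.norm_of_nonneg (sq_nonneg _)]
  refine sq_le_sq' ?_ ?_ <;> linarith [a₁.1, a₁.2, a₂.1, a₂.2]

/-- Strong concavity of the objective: the gain of the midpoint over the average. -/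
theorem integral_sq_sub_le (h₁ : IsFunctionallyGenerated π₁ Φ₁)
    (h₂ : IsFunctionallyGenerated π₂ Φ₂) (hδ : 0 < δ)
    (hP : ∀ᵐ x ∂P, (∀ i, δ ≤ x.1.1 i) ∧ ∀ i, δ ≤ x.2.1 i) {S : ℝ}
    (hS : ∀ (π : openSimplex n → closedSimplex n) (Φ : EuclideanSpace ℝ (Fin n) → ℝ),
      IsFunctionallyGenerated π Φ → ∫ x, LDivergence π Φ x.2 x.1 ∂P ≤ S) :
    δ ^ 2 / 8 * ∫ x, (weightRatioPairing π₁ x.1 x.2 - weightRatioPairing π₂ x.1 x.2) ^ 2 ∂P ≤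
      S - (∫ x, LDivergence π₁ Φ₁ x.2 x.1 ∂P + ∫ x, LDivergence π₂ Φ₂ x.2 x.1 ∂P) / 2 := by
  have i₁ := h₁.integrable_lDivergence hδ hP
  have i₂ := h₂.integrable_lDivergence hδ hP
  have i₃ := (h₁.integrable_sq_sub h₂ hδ hP).const_mul (δ ^ 2 / 8)
  have hm := h₁.midpoint h₂
  have i₁₂ : Integrable (fun x =>
      (LDivergence π₁ Φ₁ x.2 x.1 + LDivergence π₂ Φ₂ x.2 x.1) / 2) P := (i₁.add i₂).div_const 2
  have key := integral_mono_ae (i₁₂.add i₃)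
    (hm.integrable_lDivergence hδ hP) (by
      filter_upwards [hP] with x hx
      exact h₁.lDivergence_midpoint_ge h₂ hδ hx.1 hx.2)
  have e : ∫ x, (LDivergence π₁ Φ₁ x.2 x.1 + LDivergence π₂ Φ₂ x.2 x.1) / 2 +
      δ ^ 2 / 8 * (weightRatioPairing π₁ x.1 x.2 - weightRatioPairing π₂ x.1 x.2) ^ 2 ∂P =
      (∫ x, LDivergence π₁ Φ₁ x.2 x.1 ∂P + ∫ x, LDivergence π₂ Φ₂ x.2 x.1 ∂P) / 2 +
      δ ^ 2 / 8 *
        ∫ x, (weightRatioPairing π₁ x.1 x.2 - weightRatioPairing π₂ x.1 x.2) ^ 2 ∂P := by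
    rw [integral_add i₁₂ i₃, integral_div, integral_add i₁ i₂,
      integral_const_mul]
  have key' := (e.symm.le.trans key).trans (hS _ _ hm)
  linarith

end IsFunctionallyGenerated

/-! ### Uniqueness. -/

theorem IsOptimalPortfolio.ae_weightRatioPairing_eq {n : ℕ}
    {π₁ π₂ : openSimplex n → closedSimplex n} {Φ₁ Φ₂ : EuclideanSpace ℝ (Fin n) → ℝ}
    {P : Measure (openSimplex n × openSimplex n)} [IsProbabilityMeasure P]
    (h₁ : IsOptimalPortfolio P π₁ Φ₁) (h₂ : IsOptimalPortfolio P π₂ Φ₂) {δ : ℝ} (hδ : 0 < δ)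
    (hP : ∀ᵐ x ∂P, (∀ i, δ ≤ x.1.1 i) ∧ ∀ i, δ ≤ x.2.1 i) :
    ∀ᵐ x ∂P, weightRatioPairing π₁ x.1 x.2 = weightRatioPairing π₂ x.1 x.2 := by
  -- With the first optimal value as the upper bound `S`, the right-hand side is nonpositive because
  -- the second value is at least as large.
  have h := h₁.1.integral_sq_sub_le h₂.1 hδ hP h₁.2
  have h12 := h₂.2 _ _ h₁.1
  have h0 : 0 ≤ ∫ x,
      (weightRatioPairing π₁ x.1 x.2 - weightRatioPairing π₂ x.1 x.2) ^ 2 ∂P :=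
    integral_nonneg fun _ => sq_nonneg _
  have h3 : ∫ x,
      (weightRatioPairing π₁ x.1 x.2 - weightRatioPairing π₂ x.1 x.2) ^ 2 ∂P = 0 := by
    refine le_antisymm ?_ h0
    by_contra! hcon
    have : 0 < δ ^ 2 / 8 := by positivity
    nlinarith [mul_pos this hcon]
  rw [integral_eq_zero_iff_of_nonneg (fun _ => sq_nonneg _)
    (h₁.1.integrable_sq_sub h₂.1 hδ hP)] at h3
  filter_upwards [h3] with x hx
  exact sub_eq_zero.1 (pow_eq_zero_iff two_ne_zero |>.1 hx)

/-- Portfolios are determined at `p` by their pairings with displacements in all directions. -/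
theorem portfolio_eq_of_weightRatioPairing_eq {n : ℕ}
    {π₁ π₂ : openSimplex n → closedSimplex n} {p : openSimplex n}
    (h : ∀ v : EuclideanSpace ℝ (Fin n), ∑ i, v i = 0 → ∃ c : ℝ, 0 < c ∧ ∃ q : openSimplex n,
      weightRatioPairing π₁ p q = weightRatioPairing π₂ p q ∧ q.1 = p.1 + c • v) :
    π₁ p = π₂ p := by
  have key : ∀ v : EuclideanSpace ℝ (Fin n), ∑ i, v i = 0 →
      ∑ i, ((π₁ p).1 i - (π₂ p).1 i) / p.1 i * v i = 0 := by
    intro v hv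
    obtain ⟨c, hc, q, hq, hqv⟩ := h v hv
    have h1 : c * ∑ i, ((π₁ p).1 i - (π₂ p).1 i) / p.1 i * v i =
        weightRatioPairing π₁ p q - weightRatioPairing π₂ p q := by
      rw [weightRatioPairing, weightRatioPairing, ← Finset.sum_sub_distrib, Finset.mul_sum]
      refine Finset.sum_congr rfl fun i _ => ?_
      rw [hqv]
      simp only [PiLp.add_apply, PiLp.smul_apply, smul_eq_mul]
      ring
    rw [hq, sub_self] at h1
    exact (mul_eq_zero.1 h1).resolve_left hc.ne'
  -- Testing with `e_j - e_k` makes `π₁ p - π₂ p` a multiple of `p`; since both portfolios sum to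
  -- one, the multiple is zero.
  have hconst : ∀ j k, ((π₁ p).1 j - (π₂ p).1 j) / p.1 j =
      ((π₁ p).1 k - (π₂ p).1 k) / p.1 k := by
    intro j k
    have := key (EuclideanSpace.single j 1 - EuclideanSpace.single k 1) (by simp)
    simpa [mul_sub, Finset.sum_sub_distrib, sub_eq_zero] using this
  refine Subtype.ext (PiLp.ext fun k => ?_)
  have hk : ∀ j, (π₁ p).1 j - (π₂ p).1 j = ((π₁ p).1 k - (π₂ p).1 k) / p.1 k * p.1 j :=
    fun j => by rw [← hconst j k, div_mul_cancel₀ _ (p.2.1 j).ne']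
  have hsum : ((π₁ p).1 k - (π₂ p).1 k) / p.1 k = 0 := by
    calc _ = ((π₁ p).1 k - (π₂ p).1 k) / p.1 k * ∑ j, p.1 j := by rw [p.2.2, mul_one]
      _ = ∑ j, ((π₁ p).1 j - (π₂ p).1 j) := by
        rw [Finset.mul_sum]
        exact Finset.sum_congr rfl fun j _ => (hk j).symm
      _ = 0 := by rw [Finset.sum_sub_distrib, (π₁ p).2.2, (π₂ p).2.2, sub_self]
  have := hk k
  rw [hsum, zero_mul] at this
  linarith

theorem ae_portfolio_eq_of_supportCondition {n : ℕ}
    {π₁ π₂ : openSimplex n → closedSimplex n}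
    {P : Measure (openSimplex n × openSimplex n)} [IsProbabilityMeasure P]
    (h : ∀ᵐ x ∂P, weightRatioPairing π₁ x.1 x.2 = weightRatioPairing π₂ x.1 x.2)
    {f : openSimplex n → ℝ≥0∞} {κ : Kernel (openSimplex n) (openSimplex n)} (hf : Measurable f)
    [IsMarkovKernel κ] (hfst : P.fst = (simplexMeasure n).withDensity f)
    (hP : P = P.fst.compProd κ) (hs : SupportCondition f κ) :
    ∀ᵐ p ∂(simplexMeasure n), 0 < f p → π₁ p = π₂ p := by
  rw [hP] at h
  have h1 := Measure.ae_ae_of_ae_compProd h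
  rw [hfst, ae_withDensity_iff hf] at h1
  filter_upwards [h1, hs] with p hp hsp hfp
  -- The pairings agree `κ p`-almost everywhere; closedness extends this to every point of the
  -- support.
  have hclosed : IsClosed
      {q : openSimplex n | weightRatioPairing π₁ p q = weightRatioPairing π₂ p q} := by
    unfold weightRatioPairing
    exact isClosed_eq (by fun_prop) (by fun_prop)
  have hsub := Measure.support_subset_of_isClosed hclosed (hp hfp.ne')
  refine portfolio_eq_of_weightRatioPairing_eq fun v hv => ?_
  obtain ⟨c, hc, q, hq, hqv⟩ := hsp hfp v hv
  exact ⟨c, hc, q, hsub hq, hqv⟩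

/-! ### Compactness: measurable limit points and convergent generating functions. -/

/-- A bounded sequence of measurable functions converges along measurably chosen indices. -/
theorem exists_measurable_index_tendsto {α : Type*} [MeasurableSpace α] {f : ℕ → α → ℝ}
    (hf : ∀ k, Measurable (f k)) (h0 : ∀ k a, 0 ≤ f k a) (h1 : ∀ k a, f k a ≤ 1) :
    ∃ N : ℕ → α → ℕ, (∀ j, Measurable (N j)) ∧ (∀ a, Tendsto (fun j => N j a) atTop atTop) ∧
      ∀ a, ∃ l, Tendsto (fun j => f (N j a) a) atTop (𝓝 l) := by
  classical
  set g : α → ℝ := fun a => liminf (fun k => f k a) atTop with hg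
  have hgm : Measurable g := Measurable.liminf hf
  have hex : ∀ (j : ℕ) (a : α), ∃ k, j ≤ k ∧ |f k a - g a| < 1 / ((j : ℝ) + 1) := by
    intro j a
    have hj : (0 : ℝ) < 1 / ((j : ℝ) + 1) := by positivity
    have b1 : IsBoundedUnder (· ≥ ·) atTop fun k => f k a :=
      isBoundedUnder_of ⟨0, fun k => h0 k a⟩
    have b2 : IsBoundedUnder (· ≤ ·) atTop fun k => f k a :=
      isBoundedUnder_of ⟨1, fun k => h1 k a⟩
    have e1 : ∀ᶠ k in atTop, g a - 1 / ((j : ℝ) + 1) < f k a :=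
      eventually_lt_of_lt_liminf (by linarith) b1
    have e2 : ∃ᶠ k in atTop, f k a < g a + 1 / ((j : ℝ) + 1) :=
      frequently_lt_of_liminf_lt b2.isCoboundedUnder_ge (by linarith)
    obtain ⟨k, hk2, hk1, hkj⟩ := (e2.and_eventually (e1.and (eventually_ge_atTop j))).exists
    exact ⟨k, hkj, abs_lt.2 ⟨by linarith, by linarith⟩⟩
  -- Taking the least index `≥ j` at which the sequence is `1 / (j + 1)`-close to its liminf makes
  -- the choice measurable.
  refine ⟨fun j a => Nat.find (hex j a), fun j => ?_, fun a => ?_, fun a => ⟨g a, ?_⟩⟩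
  · refine measurable_find (hex j) fun k => ?_
    exact (MeasurableSet.const _).inter
      (measurableSet_lt (measurable_norm.comp ((hf k).sub hgm)) measurable_const)
  · exact tendsto_atTop_mono (fun j => (Nat.find_spec (hex j a)).1) tendsto_id
  · rw [tendsto_iff_dist_tendsto_zero]
    exact squeeze_zero (fun _ => dist_nonneg) (fun j => (Nat.find_spec (hex j a)).2.le)
      tendsto_one_div_add_atTop_nhds_zero_nat

theorem exists_measurable_index_tendsto_finset {α ι : Type*} [MeasurableSpace α]
    {f : ι → ℕ → α → ℝ} (hf : ∀ i k, Measurable (f i k)) (h0 : ∀ i k a, 0 ≤ f i k a)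
    (h1 : ∀ i k a, f i k a ≤ 1) (s : Finset ι) :
    ∃ N : ℕ → α → ℕ, (∀ j, Measurable (N j)) ∧ (∀ a, Tendsto (fun j => N j a) atTop atTop) ∧
      ∀ a, ∀ i ∈ s, ∃ l, Tendsto (fun j => f i (N j a) a) atTop (𝓝 l) := by
  classical
  induction s using Finset.induction_on with
  | empty => exact ⟨fun j _ => j, fun j => measurable_const, fun a => tendsto_id, by simp⟩
  | insert i s _ ih =>
    obtain ⟨N, hNm, hN, hNs⟩ := ih
    -- Indices already chosen are refined one coordinate at a time; countability of `ℕ` keeps the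
    -- composites measurable.
    have hm : ∀ j, Measurable fun a => f i (N j a) a := fun j =>
      (measurable_from_prod_countable_right (f := fun x : ℕ × α => f i x.1 x.2)
        fun k => hf i k).comp ((hNm j).prodMk measurable_id)
    obtain ⟨M, hMm, hM, hMi⟩ := exists_measurable_index_tendsto hm (fun j a => h0 _ _ _)
      fun j a => h1 _ _ _
    refine ⟨fun j a => N (M j a) a, fun j => ?_, fun a => (hN a).comp (hM a), fun a i' hi' => ?_⟩
    · exact (measurable_from_prod_countable_right (f := fun x : ℕ × α => N x.1 x.2)
        fun k => hNm k).comp ((hMm j).prodMk measurable_id)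
    · rcases Finset.mem_insert.1 hi' with rfl | hi'
      · exact hMi a
      · obtain ⟨l, hl⟩ := hNs a i' hi'
        exact ⟨l, hl.comp (hM a)⟩

/-- Measurable selection of a limit point of a sequence of portfolios. -/
theorem exists_measurable_limit_portfolio {n : ℕ} {π : ℕ → openSimplex n → closedSimplex n}
    (hπ : ∀ k, Measurable (π k)) :
    ∃ (ρ : openSimplex n → closedSimplex n) (N : ℕ → openSimplex n → ℕ), Measurable ρ ∧
      (∀ p, Tendsto (fun j => N j p) atTop atTop) ∧
      ∀ p, Tendsto (fun j => π (N j p) p) atTop (𝓝 (ρ p)) := by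
  have hm (i : Fin n) (k : ℕ) : Measurable fun p => (π k p).1 i := by
    have h0 : Measurable fun p : EuclideanSpace ℝ (Fin n) => p i := by fun_prop
    exact h0.comp (measurable_subtype_coe.comp (hπ k))
  obtain ⟨N, hNm, hN, hlim⟩ := exists_measurable_index_tendsto_finset
    (f := fun i k p => (π k p).1 i) hm (fun i k p => (π k p).2.1 i)
    (fun i k p => by
      rw [← (π k p).2.2]
      exact Finset.single_le_sum (f := fun i => (π k p).1 i) (fun j _ => (π k p).2.1 j)
        (Finset.mem_univ i)) Finset.univ
  choose l hl using fun p i => hlim p i (Finset.mem_univ i)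
  have hρ : ∀ p, (WithLp.toLp 2 (l p) : EuclideanSpace ℝ (Fin n)) ∈ closedSimplex n := by
    refine fun p => ⟨fun i => ge_of_tendsto' (hl p i) fun j => (π (N j p) p).2.1 i, ?_⟩
    refine tendsto_nhds_unique (tendsto_finsetSum _ fun i _ => hl p i) ?_
    simp only [(π _ _).2.2]
    exact tendsto_const_nhds
  have ht : ∀ p, Tendsto (fun j => π (N j p) p) atTop (𝓝 ⟨_, hρ p⟩) := by
    intro p
    rw [tendsto_subtype_rng]
    have h1 : Tendsto (fun j => (π (N j p) p).1.ofLp) atTop (𝓝 (l p)) :=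
      tendsto_pi_nhds.2 fun i => hl p i
    exact ((PiLp.continuous_toLp 2 _).tendsto (l p)).comp h1
  refine ⟨fun p => ⟨_, hρ p⟩, N, ?_, hN, ht⟩
  refine measurable_of_tendsto_metrizable (f := fun j p => π (N j p) p) (fun j => ?_)
    (tendsto_pi_nhds.2 ht)
  exact (measurable_from_prod_countable_right
    (f := fun x : ℕ × openSimplex n => π x.1 x.2) fun k => hπ k).comp
    ((hNm j).prodMk measurable_id)

/-- Arzelà–Ascoli for functions that are nonexpansive with respect to `logDist`. -/
theorem exists_subseq_tendsto_of_logDist {n : ℕ} {L : ℕ → openSimplex n → ℝ}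
    (hL : ∀ k p q, |L k q - L k p| ≤ logDist p q) (c : openSimplex n) (hc : ∀ k, L k c = 0) :
    ∃ φ : ℕ → ℕ, StrictMono φ ∧ ∀ q, ∃ l, Tendsto (fun k => L (φ k) q) atTop (𝓝 l) := by
  have : Nonempty (openSimplex n) := ⟨c⟩
  let D := TopologicalSpace.denseSeq (openSimplex n)
  -- Since `L k c = 0`, the values on a dense sequence stay in a compact product of intervals; the
  -- `ε / 3` argument then covers all `q`.
  have hcomp : IsCompact (Set.univ.pi fun i : ℕ =>
      Set.Icc (-logDist c (D i)) (logDist c (D i))) := isCompact_univ_pi fun i => isCompact_Icc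
  obtain ⟨x, -, φ, hφ, hx⟩ := hcomp.tendsto_subseq (x := fun k i => L k (D i)) fun k i _ => by
    have := hL k c (D i)
    rw [hc, sub_zero] at this
    exact abs_le.1 this
  refine ⟨φ, hφ, fun q => cauchySeq_tendsto_of_complete (Metric.cauchySeq_iff'.2 fun ε hε => ?_)⟩
  have hev : ∀ᶠ d in 𝓝 q, logDist q d < ε / 3 := by
    have h0 := (continuous_logDist q).tendsto q
    rw [logDist_self] at h0
    exact h0.eventually_lt_const (by positivity)
  obtain ⟨_, hd, i, rfl⟩ := mem_closure_iff_nhds.1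
    (TopologicalSpace.denseRange_denseSeq (openSimplex n) q) _ hev
  have hd' : logDist q (D i) < ε / 3 := hd
  obtain ⟨M, hM⟩ := Metric.cauchySeq_iff'.1 ((tendsto_pi_nhds.1 hx i).cauchySeq) (ε / 3)
    (by positivity)
  refine ⟨M, fun k hk => ?_⟩
  have h1 := hM k hk
  have h2 := abs_le.1 (hL (φ k) q (D i))
  have h3 := abs_le.1 (hL (φ M) q (D i))
  simp only [Function.comp, Real.dist_eq] at h1 ⊢
  rw [abs_lt] at h1 ⊢
  constructor <;> linarith [h1.1, h1.2, h2.1, h2.2, h3.1, h3.2]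

/-! ### Existence of a maximizer. -/

/-- Near-maximizers of the objective have almost everywhere convergent pairings. -/
theorem ae_exists_tendsto_weightRatioPairing {n : ℕ}
    {π : ℕ → openSimplex n → closedSimplex n} {Φ : ℕ → EuclideanSpace ℝ (Fin n) → ℝ}
    (h : ∀ k, IsFunctionallyGenerated (π k) (Φ k))
    {P : Measure (openSimplex n × openSimplex n)} [IsProbabilityMeasure P] {δ : ℝ} (hδ : 0 < δ)
    (hP : ∀ᵐ x ∂P, (∀ i, δ ≤ x.1.1 i) ∧ ∀ i, δ ≤ x.2.1 i) {S : ℝ}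
    (hS : ∀ (π : openSimplex n → closedSimplex n) (Φ : EuclideanSpace ℝ (Fin n) → ℝ),
      IsFunctionallyGenerated π Φ → ∫ x, LDivergence π Φ x.2 x.1 ∂P ≤ S)
    (hk : ∀ k, S - ((1 / 2 : ℝ) ^ k) ^ 2 ≤ ∫ x, LDivergence (π k) (Φ k) x.2 x.1 ∂P) :
    ∀ᵐ x ∂P, ∃ l, Tendsto (fun k => weightRatioPairing (π k) x.1 x.2) atTop (𝓝 l) := by
  have hm := fun k => measurable_weightRatioPairing (h k).measurable
  refine Lp.ae_tendsto_of_cauchy_eLpNorm (p := 1)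
    (B := fun N => ENNReal.ofReal ((1 + 8 / δ ^ 2) * (1 / 2 : ℝ) ^ N))
    (fun k => (hm k).aestronglyMeasurable) le_rfl ?_ fun N k m hNk hNm => ?_
  · exact (summable_geometric_two.mul_left _).tsum_ofReal_ne_top
  · set t : ℝ := (1 / 2 : ℝ) ^ N with ht
    have ht0 : 0 < t := by positivity
    have hmono : ∀ j, N ≤ j → ((1 / 2 : ℝ) ^ j) ^ 2 ≤ t ^ 2 := fun j hj =>
      pow_le_pow_left₀ (by positivity)
        (pow_le_pow_of_le_one (by norm_num) (by norm_num) hj) 2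
    have hsq := (h k).integral_sq_sub_le (h m) hδ hP hS
    have isq := (h k).integrable_sq_sub (h m) hδ hP
    set I := ∫ x, (weightRatioPairing (π k) x.1 x.2 - weightRatioPairing (π m) x.1 x.2) ^ 2 ∂P
      with hI
    have hI2 : I ≤ 8 / δ ^ 2 * t ^ 2 := by
      have h1 : δ ^ 2 / 8 * I ≤ t ^ 2 := by
        linarith [hk k, hk m, hmono k hNk, hmono m hNm]
      calc I = 8 / δ ^ 2 * (δ ^ 2 / 8 * I) := by field_simp
        _ ≤ _ := by gcongr
    -- Young's inequality with parameter `t` turns the `L²` bound of order `t ^ 2` into an `L¹`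
    -- bound of order `t`, summable in `N`.
    have hpt : ∀ x : openSimplex n × openSimplex n,
        ‖weightRatioPairing (π k) x.1 x.2 - weightRatioPairing (π m) x.1 x.2‖ ≤
        t / 2 + (2 * t)⁻¹ *
          (weightRatioPairing (π k) x.1 x.2 - weightRatioPairing (π m) x.1 x.2) ^ 2 := by
      intro x
      set y := weightRatioPairing (π k) x.1 x.2 - weightRatioPairing (π m) x.1 x.2
      have e : t / 2 + (2 * t)⁻¹ * y ^ 2 - ‖y‖ = (2 * t)⁻¹ * (t - ‖y‖) ^ 2 := by
        rw [← sq_abs y, Real.norm_eq_abs]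
        field_simp
        ring
      have : 0 ≤ (2 * t)⁻¹ * (t - ‖y‖) ^ 2 := by positivity
      linarith
    have idom : Integrable (fun x : openSimplex n × openSimplex n => t / 2 + (2 * t)⁻¹ *
        (weightRatioPairing (π k) x.1 x.2 - weightRatioPairing (π m) x.1 x.2) ^ 2) P :=
      (integrable_const _).add (isq.const_mul _)
    have idiff : Integrable (fun x : openSimplex n × openSimplex n =>
        weightRatioPairing (π k) x.1 x.2 - weightRatioPairing (π m) x.1 x.2) P :=
      idom.mono' ((hm k).sub (hm m)).aestronglyMeasurable (.of_forall hpt)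
    have hle := integral_mono idiff.norm idom hpt
    rw [integral_add (integrable_const _) (isq.const_mul _), integral_const_mul, ← hI,
      integral_const, probReal_univ, one_smul] at hle
    rw [eLpNorm_one_eq_lintegral_enorm]
    refine (ofReal_integral_norm_eq_lintegral_enorm idiff).symm.trans_lt ?_
    refine (ENNReal.ofReal_lt_ofReal_iff (by positivity)).2 ?_
    calc _ ≤ t / 2 + (2 * t)⁻¹ * I := hle
      _ ≤ t / 2 + (2 * t)⁻¹ * (8 / δ ^ 2 * t ^ 2) := by gcongr
      _ = (1 / 2 + 8 / δ ^ 2 / 2) * t := by field_simp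
      _ < (1 + 8 / δ ^ 2) * t := by
        have : 0 < 8 / δ ^ 2 := by positivity
        exact mul_lt_mul_of_pos_right (by linarith) ht0

theorem exists_isOptimalPortfolio {n : ℕ}
    (P : Measure (openSimplex n × openSimplex n)) [IsProbabilityMeasure P] {δ : ℝ} (hδ : 0 < δ)
    (hP : ∀ᵐ x ∂P, (∀ i, δ ≤ x.1.1 i) ∧ ∀ i, δ ≤ x.2.1 i) :
    ∃ (π : openSimplex n → closedSimplex n) (Φ : EuclideanSpace ℝ (Fin n) → ℝ),
      IsOptimalPortfolio P π Φ := by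
  classical
  obtain ⟨⟨c, -⟩⟩ : Nonempty (openSimplex n × openSimplex n) := nonempty_of_isProbabilityMeasure P
  set V : Set ℝ := {J | ∃ (π : openSimplex n → closedSimplex n)
    (Φ : EuclideanSpace ℝ (Fin n) → ℝ), IsFunctionallyGenerated π Φ ∧
      ∫ x, LDivergence π Φ x.2 x.1 ∂P = J} with hV
  have hne : V.Nonempty := ⟨_, _, _, isFunctionallyGenerated_market n, rfl⟩
  have hbdd : BddAbove V := ⟨2 * Real.log δ⁻¹, by
    rintro _ ⟨π, Φ, h, rfl⟩
    exact h.integral_lDivergence_le hδ hP⟩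
  have hS : ∀ (π : openSimplex n → closedSimplex n) (Φ : EuclideanSpace ℝ (Fin n) → ℝ),
      IsFunctionallyGenerated π Φ → ∫ x, LDivergence π Φ x.2 x.1 ∂P ≤ sSup V :=
    fun π Φ h => le_csSup hbdd ⟨π, Φ, h, rfl⟩
  have hseq : ∀ k : ℕ, ∃ (π : openSimplex n → closedSimplex n)
      (Φ : EuclideanSpace ℝ (Fin n) → ℝ), IsFunctionallyGenerated π Φ ∧
      sSup V - ((1 / 2 : ℝ) ^ k) ^ 2 ≤ ∫ x, LDivergence π Φ x.2 x.1 ∂P := by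
    intro k
    have : (0 : ℝ) < ((1 / 2 : ℝ) ^ k) ^ 2 := by positivity
    obtain ⟨_, ⟨π, Φ, h, rfl⟩, hlt⟩ := exists_lt_of_lt_csSup hne
      (show sSup V - ((1 / 2 : ℝ) ^ k) ^ 2 < sSup V by linarith)
    exact ⟨π, Φ, h, hlt.le⟩
  choose π Φ hFG hJ using hseq
  have hae := ae_exists_tendsto_weightRatioPairing hFG hδ hP hS hJ
  obtain ⟨φ, hφ, hlim⟩ := exists_subseq_tendsto_of_logDist
    (L := fun k p => Real.log (Φ k p) - Real.log (Φ k c))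
    (fun k p q => by
      rw [sub_sub_sub_cancel_right]
      exact (hFG k).abs_log_sub_log_le p q) c (fun k => sub_self _)
  choose l hl using hlim
  -- The normalization at `c` cancels in differences.
  have hdiff : ∀ p q : openSimplex n, Tendsto
      (fun k => Real.log (Φ (φ k) q) - Real.log (Φ (φ k) p)) atTop (𝓝 (l q - l p)) := by
    intro p q
    simpa only [sub_sub_sub_cancel_right] using (hl q).sub (hl p)
  obtain ⟨ρ, N, hρm, hN, hρ⟩ := exists_measurable_limit_portfolio
    (fun k => (hFG (φ k)).measurable)
  have hpair : ∀ p q : openSimplex n, Tendsto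
      (fun j => weightRatioPairing (π (φ (N j p))) p q) atTop (𝓝 (weightRatioPairing ρ p q)) := by
    intro p q
    have hcont : Continuous fun w : closedSimplex n =>
        ∑ i, w.1 i / p.1 i * (q.1 i - p.1 i) := by fun_prop
    exact (hcont.tendsto (ρ p)).comp (hρ p)
  set Ψ : EuclideanSpace ℝ (Fin n) → ℝ := fun x =>
    if hx : x ∈ openSimplex n then Real.exp (l ⟨x, hx⟩) else 1 with hΨ
  have hΨp : ∀ p : openSimplex n, Ψ p = Real.exp (l p) := fun p => dif_pos p.2
  have hopt : IsFunctionallyGenerated ρ Ψ := by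
    refine .of_superdiff hρm (fun p hp => ?_) fun p q => ?_
    · rw [hΨp ⟨p, hp⟩]
      exact Real.exp_pos _
    · rw [hΨp, hΨp, ← Real.exp_sub]
      -- The indices `N j p` depend on the base point `p` only, so for each `p` one sequence serves
      -- every `q`.
      refine le_of_tendsto_of_tendsto'
        ((Real.continuous_exp.tendsto _).comp ((hdiff p q).comp (hN p)))
        ((hpair p q).const_add 1) fun j => ?_
      have h := hFG (φ (N j p))
      simp only [Function.comp]
      rw [← Real.log_div (h.pos _ q.2).ne' (h.pos _ p.2).ne',
        Real.exp_log (div_pos (h.pos _ q.2) (h.pos _ p.2))]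
      exact h.superdiff p q
  refine ⟨ρ, Ψ, hopt, fun π' Φ' h' => (hS π' Φ' h').trans ?_⟩
  have hT : Tendsto (fun k => ∫ x, LDivergence (π (φ k)) (Φ (φ k)) x.2 x.1 ∂P) atTop
      (𝓝 (∫ x, LDivergence ρ Ψ x.2 x.1 ∂P)) := by
    refine tendsto_integral_of_dominated_convergence (fun _ => 2 * Real.log δ⁻¹)
      (fun k => (hFG _).measurable_lDivergence.aestronglyMeasurable) (integrable_const _)
      (fun k => (hFG _).norm_lDivergence_le hδ hP) ?_
    filter_upwards [hae] with x hx
    obtain ⟨u, hu⟩ := hx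
    -- Convergence of the full sequence of pairings is essential: its limit can be read off along
    -- the indices `N j x.1`, where it is the pairing of `ρ`.
    have hu' : u = weightRatioPairing ρ x.1 x.2 :=
      tendsto_nhds_unique ((hu.comp hφ.tendsto_atTop).comp (hN x.1)) (hpair x.1 x.2)
    rw [hu'] at hu
    have hlog := ((hu.comp hφ.tendsto_atTop).const_add 1).log
      (hopt.one_add_weightRatioPairing_pos x.1 x.2).ne'
    have := hlog.sub (hdiff x.1 x.2)
    rw [hopt.lDivergence_eq, hΨp, hΨp, Real.log_exp, Real.log_exp]
    exact this.congr fun k => ((hFG _).lDivergence_eq _ _).symm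
  have hsup : Tendsto (fun k => sSup V - ((1 / 2 : ℝ) ^ φ k) ^ 2) atTop (𝓝 (sSup V)) := by
    have h0 : Tendsto (fun k : ℕ => ((1 / 2 : ℝ) ^ k) ^ 2) atTop (𝓝 (0 ^ 2)) :=
      (tendsto_pow_atTop_nhds_zero_of_lt_one (by norm_num) (by norm_num)).pow 2
    simpa using (h0.comp hφ.tendsto_atTop).const_sub (sSup V)
  exact le_of_tendsto_of_tendsto' hsup hT fun k => hJ (φ k)

/-! ### The main theorem. -/

theorem theorem5p4 {n : ℕ} (hn : 2 ≤ n)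
    (P : Measure (openSimplex n × openSimplex n)) [IsProbabilityMeasure P]
    (hP : IsDiscreteMeasure P ∨ P ≪ (simplexMeasure n).prod (simplexMeasure n))
    (K : Set (openSimplex n)) (hK : IsCompact K) (hPK : P (K ×ˢ K)ᶜ = 0) :
    -- the objective is a finite integral for every functionally generated portfolio
    (∀ (π : openSimplex n → closedSimplex n) (Φ : EuclideanSpace ℝ (Fin n) → ℝ),
      IsFunctionallyGenerated π Φ →
        Integrable (fun x => LDivergence π Φ x.2 x.1) P) ∧
    -- (i) existence of an optimal solution
    (∃ (π : openSimplex n → closedSimplex n) (Φ : EuclideanSpace ℝ (Fin n) → ℝ),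
      IsOptimalPortfolio P π Φ) ∧
    -- (ii) uniqueness
    (∀ (π₁ π₂ : openSimplex n → closedSimplex n) (Φ₁ Φ₂ : EuclideanSpace ℝ (Fin n) → ℝ),
      IsOptimalPortfolio P π₁ Φ₁ → IsOptimalPortfolio P π₂ Φ₂ →
        (∀ᵐ x ∂P, weightRatioPairing π₁ x.1 x.2 = weightRatioPairing π₂ x.1 x.2) ∧
        (P ≪ (simplexMeasure n).prod (simplexMeasure n) →
          ∀ (f : openSimplex n → ℝ≥0∞) (κ : Kernel (openSimplex n) (openSimplex n)),
            Measurable f → IsMarkovKernel κ →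
            P.fst = (simplexMeasure n).withDensity f →
            P = P.fst.compProd κ →
            SupportCondition f κ →
              ∀ᵐ p ∂(simplexMeasure n), 0 < f p → π₁ p = π₂ p)) := by
  obtain ⟨δ, hδ, hδK⟩ := openSimplex.exists_forall_le_of_isCompact hK
  have hδP : ∀ᵐ x ∂P, (∀ i, δ ≤ x.1.1 i) ∧ ∀ i, δ ≤ x.2.1 i := by
    have h : ∀ᵐ x ∂P, x ∈ K ×ˢ K := hPK
    filter_upwards [h] with x hx
    exact ⟨hδK _ hx.1, hδK _ hx.2⟩
  refine ⟨fun π Φ h => h.integrable_lDivergence hδ hδP, exists_isOptimalPortfolio P hδ hδP,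
    fun π₁ π₂ Φ₁ Φ₂ h₁ h₂ => ?_⟩
  have hae := h₁.ae_weightRatioPairing_eq h₂ hδ hδP
  exact ⟨hae, fun _ f κ hf hκ hfst hPκ hs =>
    ae_portfolio_eq_of_supportCondition hae hf hfst hPκ hs⟩
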